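/- Let $D\ge 3$. \textbf{Maps.} An edge-colored map $\mathcal M$ is a finite combinatorial map (a graph, loops and multiple edges allowed, with a cyclic order of the half-edges at every vertex) whose edges carry colors in $\{1,\dots,D\}$ and in which each vertex carries at most one cilium (a mark placed in the cyclic order around the vertex). Let $E(\mathcal M)$ and $V(\mathcal M)$ be its numbers of edges and vertices. For each color $c$ let $\mathcal M_c$ be the sub-map with all vertices and cilia and only the edges of color $c$. Its internal faces are the closed circuits along corners and edges that meet no cilium (the single corner of an isolated vertex without cilium counts as one); its external faces are the open paths along corners and edges from one cilium to the next. $F_{\rm int}(\mathcal M)$ is the total number of internal faces over all colors. The boundary graph $\partial\mathcal M$ is the bipartite $D$-colored graph with one white and one black vertex for each cilium and, for each external face of color $c$ from a source to a target cilium, an edge of color $c$ from the white vertex of the source to the black vertex of the target. For a bipartite $D$-colored graph $\mathcal B$ (every vertex having exactly one edge of each color), $p(\mathcal B)$ is the number of black vertices and $\rho(\mathcal B)$ the number of connected components. \textbf{Cumulants.} Consider the quartic model with action $N^{D-1}\big[\mathrm{Tr}_{\mathcal B_2}(\mathbb T,\overline{\mathbb T})-\tfrac z2\sum_{c=1}^D\mathrm{Tr}_{\mathcal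 B_{4,\{c\}}}(\mathbb T,\overline{\mathbb T})\big]$. Its Feynman graphs $\mathcal G$ with $n$ quartic bubbles $\mathcal B_{4,\{c\}}$ and $p$ white and $p$ black labeled external vertices are obtained by joining the white to the black vertices by $2n+p$ edges of color $0$ (propagators). Let $F_{\rm int}(\mathcal G)$ be the number of closed cycles with colors $0,c$, over all $c$, and let $\partial\mathcal G$ be the graph on the external vertices with an edge of color $c$ for each open chain with colors $0,c$. For a (not necessarily connected) bipartite $D$-colored graph $\mathcal B$ with labeled vertices and $p=p(\mathcal B)\ge 0$, define as formal power series in $z$ $$W(\mathcal B;N,z)=\sum_{n\ge0}\frac{1}{n!}\Big(\frac z2\Big)^n\sum_{\mathcal G\text{ connected},\ \partial\mathcal G=\mathcal B}A_N(\mathcal G),\qquad A_N(\mathcal G)=N^{n(D-1)+F_{\rm int}(\mathcal G)-(D-1)(2n+p)},$$ $$K(\mathcal B;N,z)=\frac{W(\mathcal B;N,z)}{N^{s(\mathcal B)}},\qquad s(\mathcal B)=D-2(D-1)p(\mathcal B)-\rho(\mathcal B),$$ where the sum runs over Wick contractions: the bubbles and their vertices are labeled, and each bubble has any color. Contracting in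 $\mathcal G$ all edges of color $0$ and, in each $\mathcal B_{4,\{c\}}$, all edges of colors $c'\ne c$, and replacing the pair of edges of color $c$ by one edge of color $c$, produces an edge-colored map $\mathcal M(\mathcal G)$; a vertex arising from an open chain of contracted edges between a white and a black external vertex carries a cilium. Let $\ell(\mathcal M)=E(\mathcal M)-V(\mathcal M)+1$ be the loop number, and let $K_\ell(\mathcal B;N,z)$ be the part of the sum defining $K$ due to the graphs with $\ell(\mathcal M(\mathcal G))=\ell$. \textbf{Lemma.} (i) For every connected edge-colored map $\mathcal M$ with boundary graph $\mathcal B=\partial\mathcal M$ one has $E(\mathcal M)-V(\mathcal M)+1\ge0$ and $$-E(\mathcal M)(D-1)+F_{\rm int}(\mathcal M)\le D-(D-1)p(\mathcal B)-\rho(\mathcal B)-(D-2)\big[E(\mathcal M)-V(\mathcal M)+1\big].$$ (ii) Hence, for every $\mathcal B$ as above, in the sense of perturbation theory (that is, for the coefficient of every power $z^n$), with $N$ ranging over the integers $N\ge1$: (a) every connected $\mathcal G$ with $\partial\mathcal G=\mathcal B$ satisfies $A_N(\mathcal G)/N^{s(\mathcal B)}\le N^{-(D-2)\,\ell(\mathcal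 M(\mathcal G))}$; (b) the coefficient $[z^n]K(\mathcal B;N,z)$ is bounded uniformly in $N$ and has a finite limit as $N\to\infty$; (c) $K$ has a $1/N$ expansion indexed by the loop number: $[z^n]K(\mathcal B;N,z)=\sum_{\ell=0}^{n}[z^n]K_\ell(\mathcal B;N,z)$; for all $\ell$ and $n$, $[z^n]K_\ell(\mathcal B;N,z)$ is $N^{-(D-2)\ell}$ times a polynomial in $1/N$ with coefficients independent of $N$; and for all $q$ and $n$, $[z^n]\big(K-\sum_{\ell\le q}K_\ell\big)=O\big(N^{-(D-2)(q+1)}\big)$, uniformly in $N$. -/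

import Mathlib

noncomputable section

namespace QuarticTensor

/-! ### Colored graphs -/

/-- A bipartite `D`-colored graph (a not necessarily connected bubble) with white vertices `W` and
black vertices `B`: every vertex has exactly one incident edge of each color, and the edge of
color `c` at the white vertex `w` ends at the black vertex `edge c w`. -/
@[ext]
structure Bubble (D : ℕ) (W B : Type*) where
  edge : Fin D → W ≃ B

namespace Bubble

variable {D : ℕ} {W B : Type*}

/-- The underlying simple graph, on white (`inl`) and black (`inr`) vertices. -/
def graph (b : Bubble D W B) : SimpleGraph (W ⊕ B) :=
  SimpleGraph.fromRel fun x y => ∃ w c, x = Sum.inl w ∧ y = Sum.inr (b.edge c w)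

/-- `p(B)`: the number of black vertices. -/
def p (_b : Bubble D W B) : ℕ := Nat.card B

/-- `ρ(B)`: the number of connected components. -/
def rho (b : Bubble D W B) : ℕ := Nat.card b.graph.ConnectedComponent

end Bubble

/-! ### Following a permutation up to the next marked point -/

section Return

variable {H X : Type*} [Finite H] [Finite X]

theorem exists_return (f : Equiv.Perm (H ⊕ X)) (x : X) :
    ∃ k : ℕ, ∃ y : X, (f ^ (k + 1)) (Sum.inr x) = Sum.inr y := by
  refine ⟨orderOf f - 1, x, ?_⟩
  have h : orderOf f - 1 + 1 = orderOf f := Nat.sub_add_cancel (orderOf_pos f)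
  rw [h, pow_orderOf_eq_one]
  rfl

open Classical in
/-- One less than the first positive time at which the `f`-orbit of the marked point `x` meets a
marked point. -/
def returnTime (f : Equiv.Perm (H ⊕ X)) (x : X) : ℕ := Nat.find (exists_return f x)

theorem returnTime_spec (f : Equiv.Perm (H ⊕ X)) (x : X) :
    ∃ y : X, (f ^ (returnTime f x + 1)) (Sum.inr x) = Sum.inr y := by
  classical
  exact Nat.find_spec (exists_return f x)

theorem returnTime_min (f : Equiv.Perm (H ⊕ X)) (x : X) {m : ℕ} (hm : m < returnTime f x)
    (y : X) : (f ^ (m + 1)) (Sum.inr x) ≠ Sum.inr y := by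
  classical
  intro h
  exact Nat.find_min (exists_return f x) hm ⟨y, h⟩

/-- The first marked point met by the orbit `f x, f (f x), …` of the marked point `x`. -/
def returnMap (f : Equiv.Perm (H ⊕ X)) (x : X) : X := (returnTime_spec f x).choose

theorem returnMap_spec (f : Equiv.Perm (H ⊕ X)) (x : X) :
    (f ^ (returnTime f x + 1)) (Sum.inr x) = Sum.inr (returnMap f x) :=
  (returnTime_spec f x).choose_spec

theorem returnMap_aux (f : Equiv.Perm (H ⊕ X)) {x y : X} (h : returnMap f x = returnMap f y)
    (hle : returnTime f x ≤ returnTime f y) : x = y := by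
  have hx := returnMap_spec f x
  have hy := returnMap_spec f y
  obtain ⟨d, hd⟩ := Nat.exists_eq_add_of_le hle
  have e : returnTime f y + 1 = (returnTime f x + 1) + d := by omega
  rw [e, pow_add, Equiv.Perm.mul_apply, ← h, ← hx] at hy
  have h2 : (f ^ d) (Sum.inr y) = Sum.inr x := (f ^ (returnTime f x + 1)).injective hy
  cases d with
  | zero => simpa using h2.symm
  | succ d => exact absurd h2 (returnTime_min f y (by omega) x)

theorem returnMap_injective (f : Equiv.Perm (H ⊕ X)) : Function.Injective (returnMap f) := by
  intro x y h
  rcases le_total (returnTime f x) (returnTime f y) with hle | hle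
  · exact returnMap_aux f h hle
  · exact (returnMap_aux f h.symm hle).symm

/-- `returnMap` as a permutation of the marked points. -/
def firstReturn (f : Equiv.Perm (H ⊕ X)) : Equiv.Perm X :=
  Equiv.ofBijective (returnMap f) (Finite.injective_iff_bijective.mp (returnMap_injective f))

/-- Follow `f`, but jump from the end of every chain of unmarked points leading from one marked
point to the next back to the beginning of this chain. -/
def closeChains (f : Equiv.Perm (H ⊕ X)) : Equiv.Perm (H ⊕ X) :=
  f.trans (Equiv.sumCongr (Equiv.refl H) (firstReturn f).symm)

theorem closeChains_pow (f : Equiv.Perm (H ⊕ X)) (x : X) (m : ℕ) (hm : m ≤ returnTime f x) :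
    (closeChains f ^ m) (Sum.inr x) = (f ^ m) (Sum.inr x) := by
  induction m with
  | zero => rfl
  | succ m ih =>
    rw [pow_succ', Equiv.Perm.mul_apply, ih (by omega)]
    have h := returnTime_min f x (m := m) (by omega)
    rw [pow_succ', Equiv.Perm.mul_apply] at h ⊢
    simp only [closeChains, Equiv.trans_apply]
    cases hz : f ((f ^ m) (Sum.inr x)) with
    | inl z => rfl
    | inr z => exact absurd hz (h z)

theorem closeChains_pow_return (f : Equiv.Perm (H ⊕ X)) (x : X) :
    (closeChains f ^ (returnTime f x + 1)) (Sum.inr x) = Sum.inr x := by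
  have h := returnMap_spec f x
  rw [pow_succ', Equiv.Perm.mul_apply] at h ⊢
  rw [closeChains_pow f x _ le_rfl]
  simp only [closeChains, Equiv.trans_apply]
  rw [h]
  have : (firstReturn f).symm (returnMap f x) = x := (firstReturn f).symm_apply_apply x
  simp [this]

theorem closeChains_sameCycle (f : Equiv.Perm (H ⊕ X)) {x y : X}
    (h : (closeChains f).SameCycle (Sum.inr x) (Sum.inr y)) : x = y := by
  obtain ⟨m, -, -, hm⟩ := h.exists_pow_eq''
  set k := returnTime f x + 1 with hk
  have hper : ∀ q : ℕ, ((closeChains f ^ k) ^ q) (Sum.inr x) = Sum.inr x := by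
    intro q
    induction q with
    | zero => rfl
    | succ q ih => rw [pow_succ', Equiv.Perm.mul_apply, ih, hk, closeChains_pow_return]
  have hmod : (closeChains f ^ (m % k)) (Sum.inr x) = Sum.inr y := by
    conv_lhs at hm => rw [← Nat.mod_add_div m k, pow_add, pow_mul, Equiv.Perm.mul_apply, hper]
    exact hm
  have hlt : m % k < k := Nat.mod_lt _ (by omega)
  rw [closeChains_pow f x _ (by omega)] at hmod
  cases hc : m % k with
  | zero =>
    rw [hc] at hmod
    exact Sum.inr.inj hmod
  | succ j =>
    rw [hc] at hmod
    exact absurd hmod (returnTime_min f x (by omega) y)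

end Return

/-- Exchanges the two elements `(e, false)`, `(e, true)` for all `e` of color `c`, and fixes
`(e, s)` for all other `e`. -/
def colorSwap {D : ℕ} {E : Type*} (color : E → Fin D) (c : Fin D) : Equiv.Perm (E × Bool) :=
  Function.Involutive.toPerm (fun h => if color h.1 = c then (h.1, !h.2) else h) (by
    rintro ⟨e, s⟩
    by_cases he : color e = c <;> simp [he])

/-- The number of cycles (fixed points included) of `f` that contain no marked point. -/
def unmarkedCycles {H X : Type*} (f : Equiv.Perm (H ⊕ X)) : ℕ :=
  Nat.card {q : Quotient (Equiv.Perm.SameCycle.setoid f) //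
    ∀ x : X, Quotient.mk (Equiv.Perm.SameCycle.setoid f) (Sum.inr x) ≠ q}

/-! ### Edge-colored maps with cilia -/

/-- An edge-colored combinatorial map with vertices `V`, edges `E` colored by `Fin D`, and cilia
`C`. The edge `e` consists of the half-edges `(e, false)` and `(e, true)`. The half-edges and cilia
hooked to a vertex are cyclically ordered by `rot`; a vertex without half-edges and cilia is an
isolated vertex. A vertex has at most one cilium. -/
structure EdgeColoredMap (D : ℕ) (V E C : Type*) where
  color : E → Fin D
  /-- the vertex to which a half-edge or a cilium is hooked -/
  vert : (E × Bool) ⊕ C → V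
  /-- the next half-edge or cilium around the same vertex -/
  rot : Equiv.Perm ((E × Bool) ⊕ C)
  vert_eq_iff : ∀ d d', vert d = vert d' ↔ rot.SameCycle d d'
  cilium_unique : ∀ i j : C, vert (Sum.inr i) = vert (Sum.inr j) → i = j

namespace EdgeColoredMap

variable {D : ℕ} {V E C : Type*}

/-- The underlying simple graph on the vertices. -/
def graph (M : EdgeColoredMap D V E C) : SimpleGraph V :=
  SimpleGraph.fromRel fun u v =>
    ∃ e : E, M.vert (Sum.inl (e, false)) = u ∧ M.vert (Sum.inl (e, true)) = v

def Connected (M : EdgeColoredMap D V E C) : Prop := M.graph.Connected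

def numVertices (_M : EdgeColoredMap D V E C) : ℕ := Nat.card V

def numEdges (_M : EdgeColoredMap D V E C) : ℕ := Nat.card E

/-- The loop number `E - V + 1`. -/
def loopNumber (M : EdgeColoredMap D V E C) : ℤ := M.numEdges - M.numVertices + 1

/-- One step along the faces of color `c`, that is, along the faces of the sub-map which retains
all the vertices and cilia but only the edges of color `c`: turn along the corner to the next
half-edge or cilium; if it is a half-edge of color `c`, go along its edge; a half-edge of another
color is absent from the sub-map and is passed over. -/
def faceStep (M : EdgeColoredMap D V E C) (c : Fin D) : Equiv.Perm ((E × Bool) ⊕ C) :=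
  M.rot.trans (Equiv.sumCongr (colorSwap M.color c) (Equiv.refl C))

/-- The number of internal faces of color `c`: the closed circuits that meet no cilium; the single
corner of an isolated vertex without cilium is one of them. -/
def internalFaces (M : EdgeColoredMap D V E C) (c : Fin D) : ℕ :=
  unmarkedCycles (M.faceStep c) + Nat.card {v : V // ∀ d, M.vert d ≠ v}

/-- `F_int`, the total number of internal faces. -/
def numInternalFaces (M : EdgeColoredMap D V E C) : ℕ := ∑ c, M.internalFaces c

/-- The boundary graph: a white and a black vertex for every cilium and, for every external face
of color `c` from a source cilium to a target cilium, an edge of color `c` between the white vertex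
of the source and the black vertex of the target. -/
def boundary [Finite E] [Finite C] (M : EdgeColoredMap D V E C) : Bubble D C C where
  edge c := firstReturn (M.faceStep c)

end EdgeColoredMap

/-! ### Feynman graphs and cumulants of the quartic model -/

/-- A Feynman graph of the quartic model with `n` labeled quartic bubbles and with `p` white and
`p` black labeled external vertices. The bubble number `k`, of type `{color k}`, has the white and
black vertices `(k, false)` and `(k, true)`; its edges of color `c ≠ color k` join the white and the
black vertex with the same label, and those of color `color k` join those with different labels.
The propagator (edge of color `0`) at the white vertex `x` ends at the black vertex `link x`. Here
`inl` denotes vertices of the bubbles and `inr` denotes the external vertices. -/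
@[ext]
structure FeynmanGraph (D n p : ℕ) where
  color : Fin n → Fin D
  link : Equiv.Perm ((Fin n × Bool) ⊕ Fin p)

namespace FeynmanGraph

variable {D n p : ℕ}

instance : Fintype (FeynmanGraph D n p) :=
  Fintype.ofEquiv ((Fin n → Fin D) × Equiv.Perm ((Fin n × Bool) ⊕ Fin p))
    { toFun := fun x => ⟨x.1, x.2⟩
      invFun := fun G => (G.color, G.link)
      left_inv := fun _ => rfl
      right_inv := fun _ => rfl }

/-- The underlying simple graph, on white (`inl`) and black (`inr`) vertices. -/
def graph (G : FeynmanGraph D n p) :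
    SimpleGraph (((Fin n × Bool) ⊕ Fin p) ⊕ ((Fin n × Bool) ⊕ Fin p)) :=
  SimpleGraph.fromRel fun x y =>
    (∃ w, x = Sum.inl w ∧ y = Sum.inr (G.link w)) ∨
    (∃ h c, x = Sum.inl (Sum.inl (colorSwap G.color c h)) ∧ y = Sum.inr (Sum.inl h))

def Connected (G : FeynmanGraph D n p) : Prop := G.graph.Connected

/-- One step along the faces of colors `0c`: from a white vertex along the edge of color `0` to a
black vertex and, if this vertex is not external, along the edge of color `c` to a white vertex. -/
def faceStep (G : FeynmanGraph D n p) (c : Fin D) : Equiv.Perm ((Fin n × Bool) ⊕ Fin p) :=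
  G.link.trans (Equiv.sumCongr (colorSwap G.color c) (Equiv.refl (Fin p)))

/-- The total number of internal faces of colors `0c`, for all `c`. -/
def numInternalFaces (G : FeynmanGraph D n p) : ℕ := ∑ c, unmarkedCycles (G.faceStep c)

/-- The boundary graph: the external vertices, with an edge of color `c` for every external face of
colors `0c`. -/
def boundary (G : FeynmanGraph D n p) : Bubble D (Fin p) (Fin p) where
  edge c := firstReturn (G.faceStep c)

/-- The scaling of the amplitude with `N`: a factor `N ^ (D - 1)` for each of the `n` bubbles,
`N` for each internal face, `N ^ (-(D - 1))` for each of the `2 n + p` edges of color `0`. -/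
def amplitude (G : FeynmanGraph D n p) (N : ℕ) : ℝ :=
  (N : ℝ) ^ ((n : ℤ) * ((D : ℤ) - 1) + (G.numInternalFaces : ℤ)
    - ((D : ℤ) - 1) * (2 * (n : ℤ) + (p : ℤ)))

/-- The map of the intermediate field representation. In each bubble `k` the edges of all colors
except `color k` are contracted, so that the two vertices labeled `(k, s)` become the half-edge
`(k, s)` of an edge of color `color k`; the edges of color `0` are contracted too. A chain of
contracted edges from the external white vertex `i` to some external black vertex becomes a vertex
with the cilium `i`, which represents this pair of external vertices. -/
def toMap (G : FeynmanGraph D n p) :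
    EdgeColoredMap D (Quotient (Equiv.Perm.SameCycle.setoid (closeChains G.link)))
      (Fin n) (Fin p) where
  color := G.color
  vert d := Quotient.mk (Equiv.Perm.SameCycle.setoid (closeChains G.link)) d
  rot := closeChains G.link
  vert_eq_iff _ _ := Quotient.eq
  cilium_unique _ _ h := closeChains_sameCycle G.link (Quotient.exact h)

end FeynmanGraph

variable {D p : ℕ}

/-- The exponent `D - 2 (D - 1) p(B) - ρ(B)` of the rescaling of the cumulants. -/
def scaling (B : Bubble D (Fin p) (Fin p)) : ℤ :=
  (D : ℤ) - 2 * ((D : ℤ) - 1) * (B.p : ℤ) - (B.rho : ℤ)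

open Classical in
/-- The cumulant `W(B; N, z)`, a formal power series in the coupling `z`: the sum over the connected
Feynman graphs with boundary graph `B`. The `n`-th order of the exponential of the interaction
`(z / 2) N ^ (D - 1) ∑ c, Tr` gives the factor `1 / n!` and a factor `1 / 2` for each bubble (the
two labelings of the vertices of a bubble are both counted in the sum). -/
def cumulant (B : Bubble D (Fin p) (Fin p)) (N : ℕ) : PowerSeries ℝ :=
  PowerSeries.mk fun n =>
    ((n.factorial : ℝ) * 2 ^ n)⁻¹ *
      ∑ G : FeynmanGraph D n p with G.Connected ∧ G.boundary = B, G.amplitude N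

/-- The rescaled cumulant `K(B; N, z)`. -/
def rescaledCumulant (B : Bubble D (Fin p) (Fin p)) (N : ℕ) : PowerSeries ℝ :=
  PowerSeries.C (((N : ℝ) ^ scaling B)⁻¹) * cumulant B N

open Classical in
/-- The part of `K(B; N, z)` due to the graphs whose map has loop number `l`. -/
def loopPart (B : Bubble D (Fin p) (Fin p)) (l : ℕ) (N : ℕ) : PowerSeries ℝ :=
  PowerSeries.C (((N : ℝ) ^ scaling B)⁻¹) * PowerSeries.mk fun n =>
    ((n.factorial : ℝ) * 2 ^ n)⁻¹ *
      ∑ G : FeynmanGraph D n p with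
        (G.Connected ∧ G.boundary = B) ∧ G.toMap.loopNumber = (l : ℤ), G.amplitude N

end QuarticTensor

end

/-!
The heart of the matter is a bound on the number of faces of an edge-colored map. Internal faces and
components of the boundary graph are counted together, as the connected components of one graph,
the *graph of faces* (`faceSetoid`): for every color it contains the steps of the face permutation
of this color, and the colors are glued at a white and a black node for every cilium. A closed face
is a component by itself, whereas every open face joins a white to a black node, so that the
remaining components are those of the boundary graph (`sum_unmarkedCycles_add_rho_le`).

The edges of the map are then activated one by one, an inactive edge being one whose half-edges are
passed over by the faces. Activating an edge multiplies one face permutation by a transposition,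
that is, it exchanges the ends of two steps in the graph of faces. This adds at most one component
(`faceCount_switch_le`). If the edge joins two components of the map, the two steps lie in different
components of the graph of faces, and these are united (`faceCount_switch_lt`): no step is a bridge
of the graph of faces, since white and black nodes have degree `D ≥ 2`, and the other nodes have one
incoming and one outgoing step. Hence, with `κ` the number of components of the map, `κ₀` the
number of its isolated vertices without cilium and `p` that of its cilia, the bound
`#faces + D κ₀ + (D - 1) p ≤ E + (D - 2) V + 2 κ` propagates from the map without edges, where it is
clear (`EdgeColoredMap.faceCount_active_le`).

The faces of a Feynman graph and of its map differ only in the labels of the black ends of the open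
faces, a relabeling that does not affect the number of components of the graph of faces. The bound
thus says that the rescaled amplitude of a connected Feynman graph is `N ^ (-k)` with
`k ≥ (D - 2) ℓ` (`FeynmanGraph.Connected.le_decay`). Every coefficient is a finite sum of such
powers, and the loop number of a graph with `n` bubbles lies between `0` and `n`.
-/

noncomputable section

namespace QuarticTensor

/-! ### Merging two classes of an equivalence relation -/

section Merge

variable {α : Type*}

/-- The equivalence relation obtained from `s` by uniting the classes of `a` and `b`. -/
def mergeSetoid (s : Setoid α) (a b : α) : Setoid α where
  r x y := s x y ∨ ((s x a ∨ s x b) ∧ (s y a ∨ s y b))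
  iseqv := by
    refine ⟨fun x => Or.inl (s.refl x), ?_, ?_⟩
    · rintro x y (h | h)
      · exact Or.inl (s.symm h)
      · exact Or.inr h.symm
    · rintro x y z (h | ⟨hx, hy⟩) (h' | ⟨hy', hz⟩)
      · exact Or.inl (s.trans h h')
      · exact Or.inr ⟨hy'.imp (s.trans h) (s.trans h), hz⟩
      · exact Or.inr ⟨hx, hy.imp (s.trans (s.symm h')) (s.trans (s.symm h'))⟩
      · exact Or.inr ⟨hx, hz⟩

theorem le_mergeSetoid (s : Setoid α) (a b : α) : s ≤ mergeSetoid s a b :=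
  fun _ _ h => Or.inl h

theorem mergeSetoid_rel (s : Setoid α) (a b : α) : mergeSetoid s a b a b :=
  Or.inr ⟨Or.inl (s.refl a), Or.inr (s.refl b)⟩

theorem mergeSetoid_le {s t : Setoid α} {a b : α} (h : s ≤ t) (hab : t a b) :
    mergeSetoid s a b ≤ t := by
  have key : ∀ x, s x a ∨ s x b → t x a := by
    rintro x (hx | hx)
    · exact h hx
    · exact t.trans (h hx) (t.symm hab)
  rintro x y (hxy | ⟨hx, hy⟩)
  · exact h hxy
  · exact t.trans (key x hx) (t.symm (key y hy))

theorem card_quotient_le_of_le [Finite α] {s t : Setoid α} (h : s ≤ t) :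
    Nat.card (Quotient t) ≤ Nat.card (Quotient s) :=
  Nat.card_le_card_of_surjective (Quotient.map' id fun _ _ hxy => h hxy)
    (Quotient.ind fun x => ⟨Quotient.mk s x, rfl⟩)

open Classical in
/-- Send the class of `a` to `none` and every other class of `s` to the class containing it. -/
def mergeMap (s : Setoid α) (a b : α) (q : Quotient s) :
    Option (Quotient (mergeSetoid s a b)) :=
  if q = Quotient.mk s a then none
  else some (Quotient.map' id (fun _ _ h => le_mergeSetoid s a b h) q)

theorem mergeMap_injective (s : Setoid α) (a b : α) : Function.Injective (mergeMap s a b) := by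
  intro q q'
  induction q using Quotient.ind with | _ x
  induction q' using Quotient.ind with | _ y
  intro h
  by_cases hx : Quotient.mk s x = Quotient.mk s a <;>
    by_cases hy : Quotient.mk s y = Quotient.mk s a
  · rw [hx, hy]
  · simp [mergeMap, hx, hy] at h
  · simp [mergeMap, hx, hy] at h
  · simp only [mergeMap, hx, hy, if_false, Option.some.injEq] at h
    have hxa : ¬ s x a := fun hh => hx (Quotient.sound hh)
    have hya : ¬ s y a := fun hh => hy (Quotient.sound hh)
    rcases (Quotient.exact h : mergeSetoid s a b x y) with h | ⟨h1, h2⟩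
    · exact Quotient.sound h
    · exact Quotient.sound (s.trans (h1.resolve_left hxa) (s.symm (h2.resolve_left hya)))

theorem mergeMap_surjective {s : Setoid α} {a b : α} (hab : ¬ s a b) :
    Function.Surjective (mergeMap s a b) := by
  rintro (_ | q)
  · exact ⟨Quotient.mk s a, if_pos rfl⟩
  · induction q using Quotient.ind with | _ x
    by_cases hx : s x a
    · refine ⟨Quotient.mk s b, ?_⟩
      have hb : Quotient.mk s b ≠ Quotient.mk s a := fun h => hab (s.symm (Quotient.exact h))
      rw [mergeMap, if_neg hb]
      exact congrArg some (Quotient.sound (Or.inr ⟨Or.inr (s.refl b), Or.inl hx⟩))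
    · refine ⟨Quotient.mk s x, ?_⟩
      rw [mergeMap, if_neg fun h => hx (Quotient.exact h)]
      rfl

theorem card_quotient_le_card_mergeSetoid [Finite α] (s : Setoid α) (a b : α) :
    Nat.card (Quotient s) ≤ Nat.card (Quotient (mergeSetoid s a b)) + 1 := by
  rw [← Finite.card_option]
  exact Nat.card_le_card_of_injective _ (mergeMap_injective s a b)

theorem card_mergeSetoid_lt [Finite α] {s : Setoid α} {a b : α} (hab : ¬ s a b) :
    Nat.card (Quotient (mergeSetoid s a b)) + 1 ≤ Nat.card (Quotient s) := by
  rw [← Finite.card_option]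
  exact Nat.card_le_card_of_surjective _ (mergeMap_surjective hab)

end Merge

/-! ### The graph of faces -/

section Faces

variable {D : ℕ} {H C : Type*}

/-- The nodes of the graph of faces: one node for every color and every unmarked point, and a
white (`inr (inl i)`) and a black (`inr (inr i)`) node, shared by all colors, for every marked
point `i`. -/
abbrev FaceNode (D : ℕ) (H C : Type*) := (Fin D × H) ⊕ (C ⊕ C)

/-- The node from which a step of color `c` at `d` starts: a marked point is left at its white
node. -/
def srcNode (c : Fin D) : H ⊕ C → FaceNode D H C := Sum.map (Prod.mk c) Sum.inl

/-- The node at which a step of color `c` to `d` arrives: a marked point is reached at its black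
node. -/
def tgtNode (c : Fin D) : H ⊕ C → FaceNode D H C := Sum.map (Prod.mk c) Sum.inr

/-- Connectedness in the graph of faces of the permutations `f c`, which has an edge from the source
node of `d` to the target node of `f c d` for all `c` and `d`. -/
def faceSetoid (f : Fin D → Equiv.Perm (H ⊕ C)) : Setoid (FaceNode D H C) :=
  Relation.EqvGen.setoid fun x y => ∃ c d, x = srcNode c d ∧ y = tgtNode c (f c d)

/-- The number of connected components of the graph of faces. -/
def faceCount (f : Fin D → Equiv.Perm (H ⊕ C)) : ℕ := Nat.card (Quotient (faceSetoid f))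

theorem faceSetoid_step (f : Fin D → Equiv.Perm (H ⊕ C)) (c : Fin D) (d : H ⊕ C) :
    faceSetoid f (srcNode c d) (tgtNode c (f c d)) :=
  Relation.EqvGen.rel _ _ ⟨c, d, rfl, rfl⟩

theorem faceSetoid_le {f : Fin D → Equiv.Perm (H ⊕ C)} {s : Setoid (FaceNode D H C)}
    (h : ∀ c d, s (srcNode c d) (tgtNode c (f c d))) : faceSetoid f ≤ s := by
  refine Setoid.eqvGen_le ?_
  rintro x y ⟨c, d, rfl, rfl⟩
  exact h c d

theorem faceSetoid_le_of_switch {f f' : Fin D → Equiv.Perm (H ⊕ C)} {c : Fin D} {a b : H ⊕ C}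
    {s : Setoid (FaceNode D H C)}
    (h : ∀ c' d, f' c' d = f c' d ∨
      c' = c ∧ ((f c' d = a ∧ f' c' d = b) ∨ (f c' d = b ∧ f' c' d = a)))
    (hs : faceSetoid f' ≤ s) (hab : s (tgtNode c a) (tgtNode c b)) : faceSetoid f ≤ s := by
  refine faceSetoid_le fun c' d => ?_
  have h' := hs (faceSetoid_step f' c' d)
  rcases h c' d with e | ⟨rfl, ⟨e, e'⟩ | ⟨e, e'⟩⟩
  · rwa [e] at h'
  · rw [e'] at h'
    rw [e]
    exact s.trans h' (s.symm hab)
  · rw [e'] at h'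
    rw [e]
    exact s.trans h' hab

theorem switch_cases {f f' : Fin D → Equiv.Perm (H ⊕ C)} [DecidableEq (H ⊕ C)] {c : Fin D}
    {a b : H ⊕ C} (hne : ∀ c', c' ≠ c → f' c' = f c')
    (hc : f' c = (f c).trans (Equiv.swap a b)) (c' : Fin D) (d : H ⊕ C) :
    f' c' d = f c' d ∨ c' = c ∧ ((f c' d = a ∧ f' c' d = b) ∨ (f c' d = b ∧ f' c' d = a)) := by
  by_cases h : c' = c
  · subst h
    by_cases ha : f c' d = a
    · exact Or.inr ⟨rfl, Or.inl ⟨ha, by simp [hc, ha]⟩⟩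
    · by_cases hb : f c' d = b
      · exact Or.inr ⟨rfl, Or.inr ⟨hb, by simp [hc, hb]⟩⟩
      · exact Or.inl (by simp [hc, Equiv.swap_apply_of_ne_of_ne ha hb])
  · exact Or.inl (by rw [hne c' h])

/-- Exchanging the ends of two steps of the same color adds at most one component to the graph of
faces. -/
theorem faceCount_switch_le [Finite H] [Finite C] [DecidableEq (H ⊕ C)]
    {f f' : Fin D → Equiv.Perm (H ⊕ C)} {c : Fin D} {a b : H ⊕ C}
    (hne : ∀ c', c' ≠ c → f' c' = f c') (hc : f' c = (f c).trans (Equiv.swap a b)) :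
    faceCount f' ≤ faceCount f + 1 := by
  have h1 := card_quotient_le_card_mergeSetoid (faceSetoid f') (tgtNode c a) (tgtNode c b)
  have h2 : faceSetoid f ≤ mergeSetoid (faceSetoid f') (tgtNode c a) (tgtNode c b) :=
    faceSetoid_le_of_switch (switch_cases hne hc) (le_mergeSetoid _ _ _) (mergeSetoid_rel _ _ _)
  have h3 := card_quotient_le_of_le h2
  unfold faceCount
  omega

/-- If the ends of two steps of the same color lie in different components of the graph of faces,
then exchanging them unites these components: a single step is never a bridge of the graph of
faces, because the numbers of steps starting and arriving in any set of nodes are congruent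
modulo `D`. -/
theorem faceSetoid_switch_rel [Finite H] [Finite C] [DecidableEq (H ⊕ C)] (hD : 2 ≤ D)
    {f f' : Fin D → Equiv.Perm (H ⊕ C)} {c : Fin D} {a b : H ⊕ C}
    (hne : ∀ c', c' ≠ c → f' c' = f c') (hc : f' c = (f c).trans (Equiv.swap a b))
    (hab : ¬ faceSetoid f (tgtNode c a) (tgtNode c b)) :
    faceSetoid f' (tgtNode c a) (tgtNode c b) := by
  classical
  by_contra hab'
  cases nonempty_fintype H
  cases nonempty_fintype C
  -- The set of nodes connected to the end `a` both before and after the exchange. Only the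
  -- original step arriving at `a` crosses its border.
  let P : FaceNode D H C → Prop := fun y =>
    faceSetoid f (tgtNode c a) y ∧ faceSetoid f' (tgtNode c a) y
  let χ : FaceNode D H C → ℤ := fun y => if P y then 1 else 0
  have hP : ∀ y, P y → χ y = 1 := fun y h => if_pos h
  have hnP : ∀ y, ¬ P y → χ y = 0 := fun y h => if_neg h
  have hcong : ∀ x y, faceSetoid f x y → faceSetoid f' x y → χ x = χ y := by
    intro x y h h'
    have : P x ↔ P y :=
      ⟨fun hx => ⟨Setoid.trans' _ hx.1 h, Setoid.trans' _ hx.2 h'⟩,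
        fun hy => ⟨Setoid.trans' _ hy.1 (Setoid.symm' _ h),
          Setoid.trans' _ hy.2 (Setoid.symm' _ h')⟩⟩
    simp only [χ, this]
  have hbalance : ∑ c', ∑ d, χ (srcNode c' d) - ∑ c', ∑ d, χ (tgtNode c' d)
      = (D : ℤ) * (∑ i, χ (Sum.inr (Sum.inl i)) - ∑ i, χ (Sum.inr (Sum.inr i))) := by
    simp only [Fintype.sum_sum_type, srcNode, tgtNode, Sum.map_inl, Sum.map_inr,
      Finset.sum_add_distrib, Finset.sum_const, Finset.card_univ, Fintype.card_fin, nsmul_eq_mul]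
    ring
  have hperm : ∑ c', ∑ d, χ (tgtNode c' (f c' d)) = ∑ c', ∑ d, χ (tgtNode c' d) :=
    Finset.sum_congr rfl fun c' _ => Equiv.sum_comp (f c') fun d => χ (tgtNode c' d)
  have hcross : ∀ c' d, ¬ (c' = c ∧ d = (f c).symm a) →
      χ (tgtNode c' (f c' d)) - χ (srcNode c' d) = 0 := by
    intro c' d hd
    have h1 := faceSetoid_step f c' d
    have h2 := faceSetoid_step f' c' d
    rcases switch_cases hne hc c' d with e | ⟨rfl, ⟨e, e'⟩ | ⟨e, e'⟩⟩
    · rw [e] at h2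
      rw [hcong _ _ h1 h2, sub_self]
    · exact absurd ⟨rfl, by rw [← e, Equiv.symm_apply_apply]⟩ hd
    · rw [e] at h1 ⊢
      rw [hnP _ fun h => hab h.1, hnP _ fun h => hab (Setoid.trans' _ h.1 h1), sub_self]
  have hone : ∑ c', ∑ d, (χ (tgtNode c' (f c' d)) - χ (srcNode c' d)) = 1 := by
    rw [Finset.sum_eq_single c, Finset.sum_eq_single ((f c).symm a)]
    · have h2 := faceSetoid_step f' c ((f c).symm a)
      have e : f' c ((f c).symm a) = b := by simp [hc]
      rw [e] at h2
      rw [Equiv.apply_symm_apply, hP _ ⟨Setoid.refl' _ _, Setoid.refl' _ _⟩,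
        hnP _ fun h => hab' (Setoid.trans' _ h.2 h2), sub_zero]
    · exact fun d _ hd => hcross c d fun h => hd h.2
    · simp
    · exact fun c' _ hc' => Finset.sum_eq_zero fun d _ => hcross c' d fun h => hc' h.1
    · simp
  simp only [Finset.sum_sub_distrib] at hone
  have hdvd : (D : ℤ) ∣ 1 :=
    ⟨-(∑ i, χ (Sum.inr (Sum.inl i)) - ∑ i, χ (Sum.inr (Sum.inr i))), by linarith⟩
  have := Int.le_of_dvd one_pos hdvd
  omega

theorem faceCount_switch_lt [Finite H] [Finite C] [DecidableEq (H ⊕ C)] (hD : 2 ≤ D)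
    {f f' : Fin D → Equiv.Perm (H ⊕ C)} {c : Fin D} {a b : H ⊕ C}
    (hne : ∀ c', c' ≠ c → f' c' = f c') (hc : f' c = (f c).trans (Equiv.swap a b))
    (hab : ¬ faceSetoid f (tgtNode c a) (tgtNode c b)) :
    faceCount f' + 1 ≤ faceCount f := by
  have h1 := card_mergeSetoid_lt hab
  have hrel := faceSetoid_switch_rel hD hne hc hab
  have h3 := card_quotient_le_of_le (mergeSetoid_le
    (faceSetoid_le_of_switch (switch_cases hne hc) le_rfl hrel) hrel)
  unfold faceCount
  omega

/-- Relabeling the marked points at which the chains end does not create components of the graph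
of faces. -/
theorem faceCount_le_relabel [Finite H] [Finite C] (f : Fin D → Equiv.Perm (H ⊕ C))
    (σ : Equiv.Perm C) :
    faceCount f ≤ faceCount fun c => (f c).trans (Equiv.sumCongr (Equiv.refl H) σ) := by
  set g : Fin D → Equiv.Perm (H ⊕ C) := fun c => (f c).trans (Equiv.sumCongr (Equiv.refl H) σ)
  let φ : FaceNode D H C → FaceNode D H C := Sum.map id (Sum.map id σ.symm)
  have hle : faceSetoid g ≤ (faceSetoid f).comap φ := by
    refine faceSetoid_le fun c d => ?_
    have h1 : φ (srcNode c d) = srcNode c d := by rcases d with d | d <;> rfl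
    have h2 : φ (tgtNode c (g c d)) = tgtNode c (f c d) := by
      simp only [g, Equiv.trans_apply]
      rcases f c d with y | y <;> simp [φ, tgtNode]
    rw [Setoid.comap_rel, h1, h2]
    exact faceSetoid_step f c d
  refine Nat.card_le_card_of_surjective (Quotient.map' φ fun _ _ h => hle h) ?_
  refine Quotient.ind fun y => ⟨Quotient.mk _ (Sum.map id (Sum.map id σ) y), ?_⟩
  refine congrArg (Quotient.mk _) ?_
  rcases y with y | y | y <;> simp [φ]

/-- The chain leaving a marked point connects its white node with the black node of the next marked
point. -/
theorem faceSetoid_firstReturn [Finite H] [Finite C] (f : Fin D → Equiv.Perm (H ⊕ C)) (c : Fin D)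
    (i : C) : faceSetoid f (Sum.inr (Sum.inl i)) (Sum.inr (Sum.inr (firstReturn (f c) i))) := by
  have key : ∀ m ≤ returnTime (f c) i,
      faceSetoid f (Sum.inr (Sum.inl i)) (tgtNode c ((f c ^ (m + 1)) (Sum.inr i))) := by
    intro m
    induction m with
    | zero => exact fun _ => faceSetoid_step f c (Sum.inr i)
    | succ m ih =>
      intro hm
      have h1 := ih (by omega)
      have h2 := faceSetoid_step f c ((f c ^ (m + 1)) (Sum.inr i))
      rw [← Equiv.Perm.mul_apply, ← pow_succ'] at h2
      refine Setoid.trans' _ h1 (Setoid.trans' _ ?_ h2)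
      cases hz : (f c ^ (m + 1)) (Sum.inr i) with
      | inl z => exact Setoid.refl' _ _
      | inr z => exact absurd hz (returnTime_min (f c) i (by omega) z)
  have h := key _ le_rfl
  rwa [returnMap_spec] at h

/-! ### Cycles and boundary components inside the graph of faces -/

/-- A point whose `closeChains f`-cycle contains no marked point has the same cycle under `f`, as the
two permutations agree along it. -/
theorem exists_closeChains_sameCycle [Finite H] [Finite C] (f : Equiv.Perm (H ⊕ C)) (d : H ⊕ C)
    (h : ∃ x, f.SameCycle (Sum.inr x) d) : ∃ i, (closeChains f).SameCycle (Sum.inr i) d := by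
  by_contra! hno
  have key : ∀ m : ℕ, (closeChains f).SameCycle d ((f ^ m) d) := by
    intro m
    induction m with
    | zero => exact Equiv.Perm.SameCycle.refl _ _
    | succ m ih =>
      have h1 := ih.trans (Equiv.Perm.sameCycle_apply_right.mpr (Equiv.Perm.SameCycle.refl _ _))
      rw [pow_succ', Equiv.Perm.mul_apply]
      generalize (f ^ m) d = y at h1
      simp only [closeChains, Equiv.trans_apply] at h1
      cases hz : f y with
      | inl z =>
        rw [hz] at h1
        exact h1
      | inr z =>
        rw [hz] at h1
        exact absurd h1.symm (hno _)
  obtain ⟨x, hx⟩ := h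
  obtain ⟨m, hm⟩ := hx.symm.exists_nat_pow_eq
  have := key m
  rw [hm] at this
  exact hno x this.symm

open Classical in
/-- The cycle or boundary component to which a node of the graph of faces belongs. -/
def faceLabel [Finite H] [Finite C] (f : Fin D → Equiv.Perm (H ⊕ C)) (b : Bubble D C C) :
    FaceNode D H C →
      ((c : Fin D) × {q : Quotient (Equiv.Perm.SameCycle.setoid (f c)) //
        ∀ x : C, Quotient.mk (Equiv.Perm.SameCycle.setoid (f c)) (Sum.inr x) ≠ q}) ⊕
      b.graph.ConnectedComponent
  | Sum.inl (c, h) =>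
    if hx : ∃ x, (f c).SameCycle (Sum.inr x) (Sum.inl h) then
      Sum.inr (b.graph.connectedComponentMk
        (Sum.inl (exists_closeChains_sameCycle (f c) _ hx).choose))
    else
      Sum.inl ⟨c, Quotient.mk _ (Sum.inl h), fun x e => hx ⟨x, Quotient.exact e⟩⟩
  | Sum.inr y => Sum.inr (b.graph.connectedComponentMk y)

theorem faceLabel_of_sameCycle [Finite H] [Finite C] {f : Fin D → Equiv.Perm (H ⊕ C)}
    {b : Bubble D C C} {c : Fin D} {h : H} {i : C}
    (hf : ∃ x, (f c).SameCycle (Sum.inr x) (Sum.inl h))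
    (hi : (closeChains (f c)).SameCycle (Sum.inr i) (Sum.inl h)) :
    faceLabel f b (Sum.inl (c, h)) = Sum.inr (b.graph.connectedComponentMk (Sum.inl i)) := by
  have := closeChains_sameCycle (f c)
    ((exists_closeChains_sameCycle (f c) _ hf).choose_spec.trans hi.symm)
  simp only [faceLabel, dif_pos hf, this]

theorem faceLabel_step [Finite H] [Finite C] (f : Fin D → Equiv.Perm (H ⊕ C)) (b : Bubble D C C)
    (hb : ∀ c, b.edge c = firstReturn (f c)) (c : Fin D) (d : H ⊕ C) :
    faceLabel f b (srcNode c d) = faceLabel f b (tgtNode c (f c d)) := by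
  have hstep : (f c).SameCycle d (f c d) :=
    Equiv.Perm.sameCycle_apply_right.mpr (Equiv.Perm.SameCycle.refl _ _)
  have hclose : (closeChains (f c)).SameCycle d (closeChains (f c) d) :=
    Equiv.Perm.sameCycle_apply_right.mpr (Equiv.Perm.SameCycle.refl _ _)
  have hadj : ∀ i j, firstReturn (f c) i = j → b.graph.connectedComponentMk (Sum.inl i) =
      b.graph.connectedComponentMk (Sum.inr j) := by
    intro i j h
    refine SimpleGraph.ConnectedComponent.sound (SimpleGraph.Adj.reachable ?_)
    rw [Bubble.graph, SimpleGraph.fromRel_adj]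
    exact ⟨Sum.inl_ne_inr, Or.inl ⟨i, c, rfl, by rw [hb, h]⟩⟩
  simp only [closeChains, Equiv.trans_apply] at hclose
  cases hz : f c d with
  | inl h' =>
    rw [hz] at hstep hclose
    change (closeChains (f c)).SameCycle d (Sum.inl h') at hclose
    cases d with
    | inl h =>
      by_cases hx : ∃ x, (f c).SameCycle (Sum.inr x) (Sum.inl h)
      · have hx' : ∃ x, (f c).SameCycle (Sum.inr x) (Sum.inl h') :=
          hx.imp fun x hx => hx.trans hstep
        obtain ⟨i, hi⟩ := exists_closeChains_sameCycle (f c) _ hx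
        exact (faceLabel_of_sameCycle hx hi).trans
          (faceLabel_of_sameCycle hx' (hi.trans hclose)).symm
      · have hx' : ¬ ∃ x, (f c).SameCycle (Sum.inr x) (Sum.inl h') :=
          fun h' => hx (h'.imp fun x hx => hx.trans hstep.symm)
        simp only [srcNode, tgtNode, Sum.map_inl, faceLabel, dif_neg hx, dif_neg hx']
        congr 3
        exact Quotient.sound hstep
    | inr i => exact (faceLabel_of_sameCycle ⟨i, hstep⟩ hclose).symm
  | inr j =>
    rw [hz] at hstep hclose
    change (closeChains (f c)).SameCycle d (Sum.inr ((firstReturn (f c)).symm j)) at hclose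
    have e := hadj _ j ((firstReturn (f c)).apply_symm_apply j)
    cases d with
    | inl h =>
      rw [show srcNode c (Sum.inl h : H ⊕ C) = Sum.inl (c, h) from rfl,
        faceLabel_of_sameCycle ⟨j, hstep.symm⟩ hclose.symm, e]
      rfl
    | inr i =>
      have := closeChains_sameCycle _ hclose
      subst this
      exact congrArg Sum.inr e

theorem faceLabel_surjective [Finite H] [Finite C] (f : Fin D → Equiv.Perm (H ⊕ C))
    (b : Bubble D C C) : Function.Surjective (faceLabel f b) := by
  rintro (⟨c, q, hq⟩ | q)
  · induction q using Quotient.ind with | _ d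
    cases d with
    | inl h =>
      refine ⟨Sum.inl (c, h), ?_⟩
      rw [faceLabel, dif_neg]
      rintro ⟨x, hx⟩
      exact hq x (Quotient.sound hx)
    | inr x => exact absurd rfl (hq x)
  · induction q using SimpleGraph.ConnectedComponent.ind with | _ y
    exact ⟨Sum.inr y, rfl⟩

/-- Every unmarked cycle and every component of the boundary graph is represented by a component of
the graph of faces. -/
theorem sum_unmarkedCycles_add_rho_le [Finite H] [Finite C] (f : Fin D → Equiv.Perm (H ⊕ C))
    (b : Bubble D C C) (hb : ∀ c, b.edge c = firstReturn (f c)) :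
    ∑ c, unmarkedCycles (f c) + b.rho ≤ faceCount f := by
  have hle : faceSetoid f ≤ Setoid.ker (faceLabel f b) :=
    faceSetoid_le fun c d => faceLabel_step f b hb c d
  have hcard := Nat.card_le_card_of_surjective
    (Quotient.lift (s := faceSetoid f) (faceLabel f b) fun _ _ h => hle h) (by
      intro y
      obtain ⟨x, hx⟩ := faceLabel_surjective f b y
      exact ⟨Quotient.mk _ x, hx⟩)
  rw [Nat.card_sum, Nat.card_sigma] at hcard
  exact hcard

end Faces

/-! ### Activating the edges of a map one by one -/

theorem colorSwap_apply_self {D : ℕ} {E : Type*} (color : E → Fin D) (e : E) (s : Bool) :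
    colorSwap color (color e) (e, s) = (e, !s) :=
  if_pos rfl

theorem colorSwap_apply_of_ne {D : ℕ} {E : Type*} {color : E → Fin D} {c : Fin D} {e : E}
    (he : color e ≠ c) (s : Bool) : colorSwap color c (e, s) = (e, s) :=
  if_neg he

namespace EdgeColoredMap

variable {D : ℕ} {V E C : Type*}

open Classical in
/-- Exchanges the two half-edges of the edges in `S` of color `c`. -/
def activeSwap (M : EdgeColoredMap D V E C) (S : Finset E) (c : Fin D) : Equiv.Perm (E × Bool) :=
  Function.Involutive.toPerm
    (fun h => if h.1 ∈ S ∧ M.color h.1 = c then (h.1, !h.2) else h) (by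
      rintro ⟨e, s⟩
      by_cases he : e ∈ S ∧ M.color e = c
      · simp [he]
      · simp [if_neg he])

/-- One step along the faces of color `c` of the sub-map with the edges in `S`; the half-edges of
the other edges are kept as passive points in the cyclic orders around the vertices. -/
def activeStep (M : EdgeColoredMap D V E C) (S : Finset E) (c : Fin D) :
    Equiv.Perm ((E × Bool) ⊕ C) :=
  M.rot.trans (Equiv.sumCongr (M.activeSwap S c) (Equiv.refl C))

/-- Connectedness of vertices by the edges in `S`. -/
def activeSetoid (M : EdgeColoredMap D V E C) (S : Finset E) : Setoid V :=
  Relation.EqvGen.setoid fun u v =>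
    ∃ e ∈ S, M.vert (Sum.inl (e, false)) = u ∧ M.vert (Sum.inl (e, true)) = v

open Classical in
theorem activeSwap_apply (M : EdgeColoredMap D V E C) (S : Finset E) (c : Fin D) (e : E)
    (s : Bool) :
    M.activeSwap S c (e, s) = if e ∈ S ∧ M.color e = c then (e, !s) else (e, s) :=
  rfl

theorem activeSwap_apply_of_mem (M : EdgeColoredMap D V E C) {S : Finset E} {e : E} (he : e ∈ S)
    (s : Bool) : M.activeSwap S (M.color e) (e, s) = (e, !s) :=
  if_pos ⟨he, rfl⟩

theorem activeSwap_apply_of_not (M : EdgeColoredMap D V E C) {S : Finset E} {c : Fin D} {e : E}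
    (he : ¬ (e ∈ S ∧ M.color e = c)) (s : Bool) : M.activeSwap S c (e, s) = (e, s) :=
  if_neg he

theorem activeStep_empty (M : EdgeColoredMap D V E C) (c : Fin D) : M.activeStep ∅ c = M.rot := by
  ext1 d
  simp only [activeStep, Equiv.trans_apply]
  rcases M.rot d with ⟨e, s⟩ | i
  · simp [M.activeSwap_apply_of_not (S := ∅) (c := c) (e := e) (by simp)]
  · rfl

theorem activeStep_univ [Fintype E] (M : EdgeColoredMap D V E C) (c : Fin D) :
    M.activeStep Finset.univ c = M.faceStep c := by
  ext1 d
  simp only [activeStep, faceStep, Equiv.trans_apply]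
  congr 2
  ext1 ⟨e, s⟩
  by_cases h : M.color e = c
  · subst h
    rw [activeSwap_apply_of_mem _ (Finset.mem_univ e), colorSwap_apply_self]
  · rw [activeSwap_apply_of_not _ fun h' => h h'.2, colorSwap_apply_of_ne h]

theorem activeStep_insert_of_ne [DecidableEq E] (M : EdgeColoredMap D V E C) (S : Finset E) (e : E)
    (c : Fin D) (hc : c ≠ M.color e) : M.activeStep (insert e S) c = M.activeStep S c := by
  simp only [activeStep]
  congr 2
  ext1 ⟨e', s⟩
  by_cases he : e' = e
  · subst he
    rw [activeSwap_apply_of_not _ fun h => hc h.2.symm,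
      activeSwap_apply_of_not _ fun h => hc h.2.symm]
  · by_cases h : e' ∈ S ∧ M.color e' = c
    · obtain ⟨h, rfl⟩ := h
      rw [activeSwap_apply_of_mem _ h, activeSwap_apply_of_mem _ (Finset.mem_insert_of_mem h)]
    · rw [activeSwap_apply_of_not _ h, activeSwap_apply_of_not]
      simpa [he] using h

/-- Activating an edge multiplies the face permutation of its color by the transposition of its
half-edges. -/
theorem activeStep_insert [DecidableEq E] [DecidableEq ((E × Bool) ⊕ C)]
    (M : EdgeColoredMap D V E C) {S : Finset E} {e : E} (he : e ∉ S) :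
    M.activeStep (insert e S) (M.color e) = (M.activeStep S (M.color e)).trans
      (Equiv.swap (Sum.inl (e, false)) (Sum.inl (e, true))) := by
  ext1 d
  simp only [activeStep, Equiv.trans_apply]
  rcases M.rot d with ⟨e', s⟩ | i
  · by_cases h : e' = e
    · subst h
      cases s <;> simp [activeSwap_apply_of_mem, activeSwap_apply_of_not, he]
    · have hS : M.activeSwap (insert e S) (M.color e) (e', s) =
          M.activeSwap S (M.color e) (e', s) := by simp [activeSwap_apply, h]
      have hfst : (M.activeSwap S (M.color e) (e', s)).1 = e' := by
        rw [activeSwap_apply]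
        split_ifs <;> rfl
      simp only [Equiv.sumCongr_apply, Sum.map_inl, hS]
      rw [Equiv.swap_apply_of_ne_of_ne] <;>
        exact fun hh => h (hfst.symm.trans (congrArg Prod.fst (Sum.inl.inj hh)))
  · simp [Equiv.swap_apply_of_ne_of_ne]

theorem activeSetoid_rel (M : EdgeColoredMap D V E C) {S : Finset E} {e : E} (he : e ∈ S) :
    M.activeSetoid S (M.vert (Sum.inl (e, false))) (M.vert (Sum.inl (e, true))) :=
  Relation.EqvGen.rel _ _ ⟨e, he, rfl, rfl⟩

theorem activeSetoid_insert [DecidableEq E] (M : EdgeColoredMap D V E C) (S : Finset E) (e : E) :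
    M.activeSetoid (insert e S) = mergeSetoid (M.activeSetoid S) (M.vert (Sum.inl (e, false)))
      (M.vert (Sum.inl (e, true))) := by
  apply le_antisymm
  · refine Setoid.eqvGen_le ?_
    rintro _ _ ⟨e', he', rfl, rfl⟩
    rcases Finset.mem_insert.mp he' with rfl | h
    · exact mergeSetoid_rel _ _ _
    · exact le_mergeSetoid _ _ _ (M.activeSetoid_rel h)
  · refine mergeSetoid_le ?_ (M.activeSetoid_rel (Finset.mem_insert_self e S))
    refine Setoid.eqvGen_le ?_
    rintro _ _ ⟨e', he', rfl, rfl⟩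
    exact M.activeSetoid_rel (Finset.mem_insert_of_mem he')

theorem activeSetoid_empty (M : EdgeColoredMap D V E C) : M.activeSetoid ∅ = ⊥ := by
  refine le_antisymm (Setoid.eqvGen_le ?_) bot_le
  rintro u v ⟨e, he, -⟩
  simp at he

theorem card_activeSetoid_empty (M : EdgeColoredMap D V E C) :
    Nat.card (Quotient (M.activeSetoid ∅)) = Nat.card V := by
  rw [activeSetoid_empty]
  exact Nat.card_congr (Equiv.ofBijective (Quotient.mk ⊥)
    ⟨fun x y h => Quotient.exact h, Quotient.mk_surjective⟩).symm

theorem Connected.subsingleton_quotient [Fintype E] {M : EdgeColoredMap D V E C}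
    (hM : M.Connected) : Subsingleton (Quotient (M.activeSetoid Finset.univ)) := by
  refine ⟨Quotient.ind fun u => Quotient.ind fun v => Quotient.sound ?_⟩
  obtain ⟨w⟩ := hM.preconnected u v
  induction w with
  | nil => exact Setoid.refl' _ _
  | cons h _ ih =>
    refine Setoid.trans' _ ?_ ih
    rw [graph, SimpleGraph.fromRel_adj] at h
    rcases h.2 with ⟨e, rfl, rfl⟩ | ⟨e, rfl, rfl⟩
    · exact M.activeSetoid_rel (Finset.mem_univ e)
    · exact Setoid.symm' _ (M.activeSetoid_rel (Finset.mem_univ e))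

theorem card_vertices_le [Finite V] (M : EdgeColoredMap D V E C) (S : Finset E) :
    Nat.card V ≤ S.card + Nat.card (Quotient (M.activeSetoid S)) := by
  classical
  induction S using Finset.induction_on with
  | empty => simp [card_activeSetoid_empty]
  | insert e S he ih =>
    have := card_quotient_le_card_mergeSetoid (M.activeSetoid S) (M.vert (Sum.inl (e, false)))
      (M.vert (Sum.inl (e, true)))
    rw [activeSetoid_insert, Finset.card_insert_of_notMem he]
    omega

theorem vert_rot (M : EdgeColoredMap D V E C) (d : (E × Bool) ⊕ C) :
    M.vert (M.rot d) = M.vert d :=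
  (M.vert_eq_iff _ _).mpr (Equiv.Perm.sameCycle_apply_left.mpr (Equiv.Perm.SameCycle.refl _ _))

/-- The vertex carrying a node of the graph of faces. -/
def nodeVertex (M : EdgeColoredMap D V E C) : FaceNode D (E × Bool) C → V :=
  Sum.elim (fun x => M.vert (Sum.inl x.2)) (Sum.elim (fun i => M.vert (Sum.inr i))
    fun i => M.vert (Sum.inr i))

theorem nodeVertex_srcNode (M : EdgeColoredMap D V E C) (c : Fin D) (d : (E × Bool) ⊕ C) :
    M.nodeVertex (srcNode c d) = M.vert d := by
  rcases d with d | d <;> rfl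

theorem nodeVertex_tgtNode (M : EdgeColoredMap D V E C) (c : Fin D) (d : (E × Bool) ⊕ C) :
    M.nodeVertex (tgtNode c d) = M.vert d := by
  rcases d with d | d <;> rfl

theorem faceSetoid_le_activeSetoid (M : EdgeColoredMap D V E C) (S : Finset E) :
    faceSetoid (M.activeStep S) ≤ (M.activeSetoid S).comap M.nodeVertex := by
  refine faceSetoid_le fun c d => ?_
  rw [Setoid.comap_rel, nodeVertex_srcNode, nodeVertex_tgtNode, ← M.vert_rot d]
  simp only [activeStep, Equiv.trans_apply]
  rcases M.rot d with ⟨e, s⟩ | i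
  · by_cases h : e ∈ S ∧ M.color e = c
    · obtain ⟨h, rfl⟩ := h
      simp only [Equiv.sumCongr_apply, Sum.map_inl, M.activeSwap_apply_of_mem h]
      cases s
      · exact M.activeSetoid_rel h
      · exact Setoid.symm' _ (M.activeSetoid_rel h)
    · simp only [Equiv.sumCongr_apply, Sum.map_inl, M.activeSwap_apply_of_not h]
      exact Setoid.refl' _ _
  · exact Setoid.refl' _ _

/-! ### The map without active edges -/

theorem faceSetoid_rot_cilium [Finite E] [Finite C] (M : EdgeColoredMap D V E C) (c : Fin D)
    (i : C) : faceSetoid (fun _ : Fin D => M.rot) (Sum.inr (Sum.inl i)) (Sum.inr (Sum.inr i)) := by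
  have h := faceSetoid_firstReturn (fun _ : Fin D => M.rot) c i
  have hi : firstReturn M.rot i = i := by
    refine M.cilium_unique _ _ ((M.vert_eq_iff _ _).mpr (Equiv.Perm.SameCycle.symm ?_))
    exact ⟨(returnTime M.rot i + 1 : ℕ), returnMap_spec M.rot i⟩
  rwa [hi] at h

theorem faceSetoid_rot_of_vert_eq [Finite E] [Finite C] (M : EdgeColoredMap D V E C) (c : Fin D)
    {d d' : (E × Bool) ⊕ C} (h : M.vert d = M.vert d') :
    faceSetoid (fun _ : Fin D => M.rot) (srcNode c d) (srcNode c d') := by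
  obtain ⟨m, rfl⟩ := ((M.vert_eq_iff _ _).mp h).exists_nat_pow_eq
  clear h
  induction m with
  | zero => exact Setoid.refl' _ _
  | succ m ih =>
    refine Setoid.trans' _ ih ?_
    rw [pow_succ', Equiv.Perm.mul_apply]
    refine Setoid.trans' _ (faceSetoid_step (fun _ : Fin D => M.rot) c _) ?_
    rcases M.rot ((M.rot ^ m) d) with y | y
    · exact Setoid.refl' _ _
    · exact Setoid.symm' _ (M.faceSetoid_rot_cilium c y)

/-- Without edges, the faces are those of isolated vertices: a vertex without cilium has one
internal face of each color, a vertex with a cilium is one component of the boundary graph. -/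
theorem faceCount_rot_le [Finite V] [Finite E] [Finite C] (hD : 1 ≤ D)
    (M : EdgeColoredMap D V E C) :
    faceCount (fun _ : Fin D => M.rot) ≤
      D * Nat.card {v : V // (∃ d, M.vert d = v) ∧ ∀ i, M.vert (Sum.inr i) ≠ v} + Nat.card C := by
  let g : (Fin D × {v : V // (∃ d, M.vert d = v) ∧ ∀ i, M.vert (Sum.inr i) ≠ v}) ⊕ C →
      Quotient (faceSetoid fun _ : Fin D => M.rot) :=
    Sum.elim (fun x => Quotient.mk _ (srcNode x.1 x.2.2.1.choose))
      fun i => Quotient.mk _ (Sum.inr (Sum.inl i))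
  have hg : Function.Surjective g := by
    refine Quotient.ind ?_
    rintro (⟨c, h⟩ | i | i)
    · by_cases hv : ∃ i, M.vert (Sum.inr i) = M.vert (Sum.inl h)
      · obtain ⟨i, hi⟩ := hv
        exact ⟨Sum.inr i, Quotient.sound (M.faceSetoid_rot_of_vert_eq c hi)⟩
      · push Not at hv
        have hd : ∃ d, M.vert d = M.vert (Sum.inl h) := ⟨_, rfl⟩
        exact ⟨Sum.inl (c, ⟨M.vert (Sum.inl h), hd, hv⟩),
          Quotient.sound (M.faceSetoid_rot_of_vert_eq c (d' := Sum.inl h) hd.choose_spec)⟩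
    · exact ⟨Sum.inr i, rfl⟩
    · exact ⟨Sum.inr i, Quotient.sound (M.faceSetoid_rot_cilium ⟨0, hD⟩ i)⟩
  have := Nat.card_le_card_of_surjective g hg
  rwa [Nat.card_sum, Nat.card_prod, Nat.card_fin] at this

theorem card_vertex_types_le [Finite V] [Finite C] (M : EdgeColoredMap D V E C) :
    Nat.card {v : V // ∀ d, M.vert d ≠ v} +
      Nat.card {v : V // (∃ d, M.vert d = v) ∧ ∀ i, M.vert (Sum.inr i) ≠ v} + Nat.card C ≤
      Nat.card V := by
  rw [← Nat.card_sum, ← Nat.card_sum]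
  refine Nat.card_le_card_of_injective
    (Sum.elim (Sum.elim Subtype.val Subtype.val) fun i => M.vert (Sum.inr i)) ?_
  rintro ((⟨v, hv⟩ | ⟨v, hv, hv'⟩) | i) ((⟨w, hw⟩ | ⟨w, hw, hw'⟩) | j) h <;>
    simp only [Sum.elim_inl, Sum.elim_inr] at h
  · simp [h]
  · obtain ⟨d, hd⟩ := hw
    exact absurd (hd.trans h.symm) (hv d)
  · exact absurd h.symm (hv _)
  · obtain ⟨d, hd⟩ := hv
    exact absurd (hd.trans h) (hw d)
  · simp [h]
  · exact absurd h.symm (hv' _)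
  · exact absurd h (hw _)
  · exact absurd h (hw' _)
  · rw [M.cilium_unique _ _ h]

/-! ### The bound on the number of faces of a map -/

/-- The bound on the number of faces of a not necessarily connected map. A new edge within a
component creates at most one component of the graph of faces; a new edge between two components
unites the two components of the graph of faces met by its sides. -/
theorem faceCount_active_le [Finite V] [Finite E] [Finite C] (hD : 3 ≤ D)
    (M : EdgeColoredMap D V E C) (S : Finset E) :
    faceCount (M.activeStep S) + D * Nat.card {v : V // ∀ d, M.vert d ≠ v} +
        (D - 1) * Nat.card C ≤
      S.card + (D - 2) * Nat.card V + 2 * Nat.card (Quotient (M.activeSetoid S)) := by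
  classical
  induction S using Finset.induction_on with
  | empty =>
    have h1 := M.faceCount_rot_le (by omega)
    have h2 : M.activeStep ∅ = fun _ => M.rot := funext M.activeStep_empty
    have h3 := Nat.mul_le_mul_left D M.card_vertex_types_le
    rw [h2, card_activeSetoid_empty]
    obtain ⟨k, rfl⟩ := Nat.exists_eq_add_of_le' hD
    simp only [show k + 3 - 1 = k + 2 by omega, show k + 3 - 2 = k + 1 by omega,
      Finset.card_empty] at *
    linarith
  | insert e S he ih =>
    rw [Finset.card_insert_of_notMem he, activeSetoid_insert]
    by_cases hrel : M.activeSetoid S (M.vert (Sum.inl (e, false))) (M.vert (Sum.inl (e, true)))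
    · have h1 := faceCount_switch_le (f := M.activeStep S) (M.activeStep_insert_of_ne S e)
        (M.activeStep_insert he)
      have h2 := card_quotient_le_of_le (mergeSetoid_le le_rfl hrel)
      omega
    · have h1 := faceCount_switch_lt (by omega) (M.activeStep_insert_of_ne S e)
        (M.activeStep_insert he) fun h => hrel (M.faceSetoid_le_activeSetoid S h)
      have h2 := card_quotient_le_card_mergeSetoid (M.activeSetoid S)
        (M.vert (Sum.inl (e, false))) (M.vert (Sum.inl (e, true)))
      omega

theorem Connected.faceCount_le [Finite V] [Finite E] [Finite C] (hD : 3 ≤ D)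
    {M : EdgeColoredMap D V E C} (hM : M.Connected) :
    (faceCount M.faceStep : ℤ) + D * Nat.card {v : V // ∀ d, M.vert d ≠ v} +
        (D - 1) * Nat.card C ≤
      Nat.card E + ((D : ℤ) - 2) * Nat.card V + 2 := by
  cases nonempty_fintype E
  have h1 := M.faceCount_active_le hD Finset.univ
  have := hM.subsingleton_quotient
  have h2 := Finite.card_le_one_iff_subsingleton.mpr this
  rw [show M.activeStep Finset.univ = M.faceStep from funext M.activeStep_univ,
    Finset.card_univ, ← Nat.card_eq_fintype_card] at h1
  zify [show 1 ≤ D by omega, show 2 ≤ D by omega] at h1 h2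
  linarith

theorem Connected.loopNumber_nonneg [Finite V] [Finite E] {M : EdgeColoredMap D V E C}
    (hM : M.Connected) : 0 ≤ M.loopNumber := by
  cases nonempty_fintype E
  have h1 := M.card_vertices_le Finset.univ
  have := hM.subsingleton_quotient
  have h2 := Finite.card_le_one_iff_subsingleton.mpr this
  rw [Finset.card_univ, ← Nat.card_eq_fintype_card] at h1
  rw [loopNumber, numEdges, numVertices]
  omega

theorem Connected.loopNumber_le [Finite V] {M : EdgeColoredMap D V E C}
    (hM : M.Connected) : M.loopNumber ≤ M.numEdges := by
  have := hM.nonempty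
  have : 0 < Nat.card V := Nat.card_pos
  rw [loopNumber, numVertices]
  omega

theorem Connected.numInternalFaces_le [Finite V] [Finite E] [Finite C] (hD : 3 ≤ D)
    {M : EdgeColoredMap D V E C} (hM : M.Connected) :
    -(M.numEdges : ℤ) * ((D : ℤ) - 1) + (M.numInternalFaces : ℤ) ≤
      (D : ℤ) - ((D : ℤ) - 1) * (M.boundary.p : ℤ) - (M.boundary.rho : ℤ)
        - ((D : ℤ) - 2) * M.loopNumber := by
  have h1 := hM.faceCount_le hD
  have h2 := sum_unmarkedCycles_add_rho_le M.faceStep M.boundary fun _ => rfl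
  have h3 : M.numInternalFaces =
      ∑ c, unmarkedCycles (M.faceStep c) + D * Nat.card {v : V // ∀ d, M.vert d ≠ v} := by
    simp [numInternalFaces, internalFaces, Finset.sum_add_distrib]
  rw [h3, loopNumber, numVertices, numEdges, Bubble.p]
  zify at h2
  push_cast
  linarith

end EdgeColoredMap

/-! ### The map of a Feynman graph -/

namespace FeynmanGraph

variable {D n p : ℕ}

/-- The face permutations of a Feynman graph and of its map differ only in the labels of the marked
points at the ends of chains. -/
theorem toMap_faceStep (G : FeynmanGraph D n p) (c : Fin D) :
    G.toMap.faceStep c = (G.faceStep c).trans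
      (Equiv.sumCongr (Equiv.refl (Fin n × Bool)) (firstReturn G.link).symm) := by
  ext1 d
  simp only [EdgeColoredMap.faceStep, faceStep, toMap, closeChains, Equiv.trans_apply]
  rcases G.link d with y | y <;> rfl

/-- The vertex of the map to which a vertex of the Feynman graph is contracted. -/
def mapVertex (G : FeynmanGraph D n p) :
    ((Fin n × Bool) ⊕ Fin p) ⊕ ((Fin n × Bool) ⊕ Fin p) →
      Quotient (Equiv.Perm.SameCycle.setoid (closeChains G.link))
  | Sum.inl w => G.toMap.vert w
  | Sum.inr b => G.toMap.vert
      (Equiv.sumCongr (Equiv.refl (Fin n × Bool)) (firstReturn G.link).symm b)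

theorem mapVertex_link (G : FeynmanGraph D n p) (w : (Fin n × Bool) ⊕ Fin p) :
    G.mapVertex (Sum.inr (G.link w)) = G.mapVertex (Sum.inl w) :=
  G.toMap.vert_rot w

theorem reachable_colorSwap (G : FeynmanGraph D n p) (h : Fin n × Bool) (c : Fin D) :
    G.toMap.graph.Reachable (G.toMap.vert (Sum.inl (colorSwap G.color c h)))
      (G.toMap.vert (Sum.inl h)) := by
  obtain ⟨e, s⟩ := h
  by_cases hc : G.color e = c
  · subst hc
    rw [colorSwap_apply_self]
    by_cases heq : G.toMap.vert (Sum.inl (e, !s)) = G.toMap.vert (Sum.inl (e, s))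
    · rw [heq]
    · refine SimpleGraph.Adj.reachable ?_
      rw [EdgeColoredMap.graph, SimpleGraph.fromRel_adj]
      refine ⟨heq, ?_⟩
      cases s
      · exact Or.inr ⟨e, rfl, rfl⟩
      · exact Or.inl ⟨e, rfl, rfl⟩
  · rw [colorSwap_apply_of_ne hc]

theorem Connected.toMap {G : FeynmanGraph D n p} (hG : G.Connected) : G.toMap.Connected := by
  have hreach : ∀ x y, G.toMap.graph.Reachable (G.mapVertex x) (G.mapVertex y) := by
    intro x y
    obtain ⟨w⟩ := hG.preconnected x y
    induction w with
    | nil => exact SimpleGraph.Reachable.refl _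
    | cons h _ ih =>
      refine SimpleGraph.Reachable.trans ?_ ih
      rw [graph, SimpleGraph.fromRel_adj] at h
      rcases h.2 with (⟨w, rfl, rfl⟩ | ⟨b, c, rfl, rfl⟩) | (⟨w, rfl, rfl⟩ | ⟨b, c, rfl, rfl⟩)
      · rw [mapVertex_link]
      · exact G.reachable_colorSwap b c
      · rw [mapVertex_link]
      · exact (G.reachable_colorSwap b c).symm
  obtain ⟨x⟩ := hG.nonempty
  have : Nonempty (Quotient (Equiv.Perm.SameCycle.setoid (closeChains G.link))) :=
    ⟨G.mapVertex x⟩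
  refine SimpleGraph.Connected.mk ?_
  exact Quotient.ind fun d => Quotient.ind fun d' => hreach (Sum.inl d) (Sum.inl d')

/-! ### Power counting -/

/-- The order in `1 / N` of the rescaled amplitude of a Feynman graph. -/
def decay (G : FeynmanGraph D n p) : ℤ :=
  scaling G.boundary - ((n : ℤ) * ((D : ℤ) - 1) + (G.numInternalFaces : ℤ)
    - ((D : ℤ) - 1) * (2 * (n : ℤ) + (p : ℤ)))

theorem Connected.le_decay (hD : 3 ≤ D) {G : FeynmanGraph D n p} (hG : G.Connected) :
    ((D : ℤ) - 2) * G.toMap.loopNumber ≤ G.decay := by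
  have h1 := hG.toMap.faceCount_le hD
  have h2 := sum_unmarkedCycles_add_rho_le G.faceStep G.boundary fun _ => rfl
  have h3 := faceCount_le_relabel G.faceStep (firstReturn G.link).symm
  rw [← show G.toMap.faceStep = _ from funext G.toMap_faceStep] at h3
  have h4 : (0 : ℤ) ≤ D * Nat.card {v // ∀ d, G.toMap.vert d ≠ v} := by positivity
  rw [decay, scaling, Bubble.p, numInternalFaces, EdgeColoredMap.loopNumber,
    EdgeColoredMap.numVertices, EdgeColoredMap.numEdges]
  simp only [Nat.card_fin] at h1 ⊢
  zify at h2 h3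
  push_cast
  linarith

theorem Connected.decay_nonneg (hD : 3 ≤ D) {G : FeynmanGraph D n p} (hG : G.Connected) :
    0 ≤ G.decay :=
  le_trans (mul_nonneg (by omega) hG.toMap.loopNumber_nonneg) (hG.le_decay hD)

theorem amplitude_div (G : FeynmanGraph D n p) {N : ℕ} (hN : 1 ≤ N) :
    G.amplitude N / (N : ℝ) ^ scaling G.boundary = (N : ℝ) ^ (-G.decay) := by
  have hN' : (N : ℝ) ≠ 0 := by positivity
  rw [amplitude, ← zpow_sub₀ hN', decay, neg_sub]

theorem inv_mul_sum_amplitude {B : Bubble D (Fin p) (Fin p)} {s : Finset (FeynmanGraph D n p)}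
    (hs : ∀ G ∈ s, G.boundary = B) {N : ℕ} (hN : 1 ≤ N) :
    ((N : ℝ) ^ scaling B)⁻¹ * (((n.factorial : ℝ) * 2 ^ n)⁻¹ * ∑ G ∈ s, G.amplitude N) =
      ((n.factorial : ℝ) * 2 ^ n)⁻¹ * ∑ G ∈ s, (N : ℝ) ^ (-G.decay) := by
  rw [mul_left_comm, Finset.mul_sum]
  congr 1
  refine Finset.sum_congr rfl fun G hG => ?_
  rw [← G.amplitude_div hN, hs G hG, div_eq_inv_mul]

/-- A sum of rescaled amplitudes of order at least `m` is `N ^ (-m)` times a polynomial in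
`1 / N`. -/
theorem exists_polynomial_sum_decay {s : Finset (FeynmanGraph D n p)} {m : ℤ}
    (hs : ∀ G ∈ s, m ≤ G.decay) (a : ℝ) :
    ∃ P : Polynomial ℝ, ∀ N : ℕ, 1 ≤ N →
      a * ∑ G ∈ s, (N : ℝ) ^ (-G.decay) = (N : ℝ) ^ (-m) * P.eval (N : ℝ)⁻¹ := by
  refine ⟨Polynomial.C a * ∑ G ∈ s, Polynomial.X ^ (G.decay - m).toNat, fun N hN => ?_⟩
  have hN' : (N : ℝ) ≠ 0 := by positivity
  rw [Polynomial.eval_mul, Polynomial.eval_C, Polynomial.eval_finsetSum, mul_left_comm,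
    Finset.mul_sum _ _ ((N : ℝ) ^ (-m))]
  congr 1
  refine Finset.sum_congr rfl fun G hG => ?_
  rw [Polynomial.eval_pow, Polynomial.eval_X, ← zpow_natCast,
    Int.toNat_of_nonneg (sub_nonneg.mpr (hs G hG)), inv_zpow', ← zpow_add₀ hN']
  congr 1
  ring

theorem abs_sum_decay_le {s : Finset (FeynmanGraph D n p)} {m : ℤ} (hs : ∀ G ∈ s, m ≤ G.decay)
    {a : ℝ} (ha : 0 ≤ a) {N : ℕ} (hN : 1 ≤ N) :
    |a * ∑ G ∈ s, (N : ℝ) ^ (-G.decay)| ≤ a * s.card * (N : ℝ) ^ (-m) := by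
  have hN' : (1 : ℝ) ≤ N := by exact_mod_cast hN
  rw [abs_of_nonneg (by positivity), mul_assoc, ← nsmul_eq_mul]
  refine mul_le_mul_of_nonneg_left (Finset.sum_le_card_nsmul _ _ _ fun G hG => ?_) ha
  exact zpow_le_zpow_right₀ hN' (neg_le_neg (hs G hG))

end FeynmanGraph

/-! ### The expansion of the cumulants -/

section Expansion

variable {D p : ℕ}

open Classical in
theorem coeff_rescaledCumulant (B : Bubble D (Fin p) (Fin p)) {N : ℕ} (hN : 1 ≤ N) (n : ℕ) :
    PowerSeries.coeff n (rescaledCumulant B N) = ((n.factorial : ℝ) * 2 ^ n)⁻¹ *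
      ∑ G : FeynmanGraph D n p with G.Connected ∧ G.boundary = B, (N : ℝ) ^ (-G.decay) := by
  rw [rescaledCumulant, PowerSeries.coeff_C_mul, cumulant, PowerSeries.coeff_mk,
    FeynmanGraph.inv_mul_sum_amplitude (fun G hG => (Finset.mem_filter.mp hG).2.2) hN]

open Classical in
theorem coeff_loopPart (B : Bubble D (Fin p) (Fin p)) (l : ℕ) {N : ℕ} (hN : 1 ≤ N) (n : ℕ) :
    PowerSeries.coeff n (loopPart B l N) = ((n.factorial : ℝ) * 2 ^ n)⁻¹ *
      ∑ G : FeynmanGraph D n p with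
        (G.Connected ∧ G.boundary = B) ∧ G.toMap.loopNumber = (l : ℤ), (N : ℝ) ^ (-G.decay) := by
  rw [loopPart, PowerSeries.coeff_C_mul, PowerSeries.coeff_mk,
    FeynmanGraph.inv_mul_sum_amplitude (fun G hG => (Finset.mem_filter.mp hG).2.1.2) hN]

open Classical in
theorem sum_coeff_loopPart (B : Bubble D (Fin p) (Fin p)) {N : ℕ} (hN : 1 ≤ N) (n k : ℕ) :
    ∑ l ∈ Finset.range k, PowerSeries.coeff n (loopPart B l N) =
      ((n.factorial : ℝ) * 2 ^ n)⁻¹ * ∑ G : FeynmanGraph D n p with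
        (G.Connected ∧ G.boundary = B) ∧ G.toMap.loopNumber < (k : ℤ), (N : ℝ) ^ (-G.decay) := by
  simp only [coeff_loopPart B _ hN]
  rw [← Finset.mul_sum]
  congr 1
  rw [← Finset.sum_fiberwise_of_maps_to (t := Finset.range k)
    (g := fun G : FeynmanGraph D n p => G.toMap.loopNumber.toNat)]
  · refine Finset.sum_congr rfl fun l hl => Finset.sum_congr ?_ fun _ _ => rfl
    rw [Finset.filter_filter]
    refine Finset.filter_congr fun G _ => ?_
    have hlk := Finset.mem_range.mp hl
    constructor
    · rintro ⟨h, h'⟩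
      exact ⟨⟨h, by omega⟩, by omega⟩
    · rintro ⟨⟨h, h'⟩, h''⟩
      have := h.1.toMap.loopNumber_nonneg
      exact ⟨h, by omega⟩
  · intro G hG
    have h := (Finset.mem_filter.mp hG).2
    have := h.1.1.toMap.loopNumber_nonneg
    rw [Finset.mem_range]
    omega

theorem coeff_rescaledCumulant_eq_sum (B : Bubble D (Fin p) (Fin p)) {N : ℕ} (hN : 1 ≤ N)
    (n : ℕ) : PowerSeries.coeff n (rescaledCumulant B N) =
      ∑ l ∈ Finset.range (n + 1), PowerSeries.coeff n (loopPart B l N) := by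
  classical
  rw [coeff_rescaledCumulant B hN, sum_coeff_loopPart B hN]
  congr 1
  refine Finset.sum_congr (Finset.filter_congr fun G _ => ?_) fun _ _ => rfl
  refine ⟨fun h => ⟨h, ?_⟩, fun h => h.1⟩
  have := h.1.toMap.loopNumber_le
  rw [EdgeColoredMap.numEdges, Nat.card_fin] at this
  push_cast
  omega

open Classical in
theorem coeff_remainder (B : Bubble D (Fin p) (Fin p)) {N : ℕ} (hN : 1 ≤ N) (n k : ℕ) :
    PowerSeries.coeff n (rescaledCumulant B N - ∑ l ∈ Finset.range k, loopPart B l N) =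
      ((n.factorial : ℝ) * 2 ^ n)⁻¹ * ∑ G : FeynmanGraph D n p with
        (G.Connected ∧ G.boundary = B) ∧ ¬ G.toMap.loopNumber < (k : ℤ),
          (N : ℝ) ^ (-G.decay) := by
  have h := Finset.sum_filter_add_sum_filter_not
    ({G | G.Connected ∧ G.boundary = B} : Finset (FeynmanGraph D n p))
    (fun G => G.toMap.loopNumber < (k : ℤ)) fun G => (N : ℝ) ^ (-G.decay)
  rw [Finset.filter_filter, Finset.filter_filter] at h
  rw [map_sub, map_sum, sum_coeff_loopPart B hN, coeff_rescaledCumulant B hN, ← mul_sub,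
    ← h, add_sub_cancel_left]

end Expansion

end QuarticTensor

end

theorem mainTheorem2 (D : ℕ) (hD : 3 ≤ D) :
    (∀ (V E C : Type) [Finite V] [Finite E] [Finite C]
        (M : QuarticTensor.EdgeColoredMap D V E C), M.Connected →
      0 ≤ M.loopNumber ∧
      -(M.numEdges : ℤ) * ((D : ℤ) - 1) + (M.numInternalFaces : ℤ) ≤
        (D : ℤ) - ((D : ℤ) - 1) * (M.boundary.p : ℤ) - (M.boundary.rho : ℤ)
          - ((D : ℤ) - 2) * M.loopNumber) ∧
    (∀ (p : ℕ) (B : QuarticTensor.Bubble D (Fin p) (Fin p)),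
      -- the bound on every term of the expansion of `K`
      (∀ (n : ℕ) (G : QuarticTensor.FeynmanGraph D n p), G.Connected → G.boundary = B →
        ∀ N : ℕ, 1 ≤ N →
          G.amplitude N / (N : ℝ) ^ QuarticTensor.scaling B ≤
            (N : ℝ) ^ (-(((D : ℤ) - 2) * G.toMap.loopNumber))) ∧
      -- `K` is bounded uniformly in `N`, order by order in the coupling
      (∀ n : ℕ, ∃ A : ℝ, ∀ N : ℕ, 1 ≤ N →
        |PowerSeries.coeff n (QuarticTensor.rescaledCumulant B N)| ≤ A) ∧
      -- `K` has a limit at large `N`, order by order in the coupling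
      (∃ Klim : PowerSeries ℝ, ∀ n : ℕ,
        Filter.Tendsto (fun N : ℕ => PowerSeries.coeff n (QuarticTensor.rescaledCumulant B N))
          Filter.atTop (nhds (PowerSeries.coeff n Klim))) ∧
      -- `K` is the sum of its parts of fixed loop number
      (∀ N : ℕ, 1 ≤ N → ∀ n : ℕ,
        PowerSeries.coeff n (QuarticTensor.rescaledCumulant B N) =
          ∑ l ∈ Finset.range (n + 1),
            PowerSeries.coeff n (QuarticTensor.loopPart B l N)) ∧
      -- the part of loop number `l` is `N ^ (-(D - 2) l)` times a polynomial in `1 / N`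
      (∀ l n : ℕ, ∃ P : Polynomial ℝ, ∀ N : ℕ, 1 ≤ N →
        PowerSeries.coeff n (QuarticTensor.loopPart B l N) =
          (N : ℝ) ^ (-(((D : ℤ) - 2) * (l : ℤ))) * P.eval (N : ℝ)⁻¹) ∧
      -- the remainder after loop number `q` is of order `N ^ (-(D - 2) (q + 1))`
      (∀ q n : ℕ, ∃ A : ℝ, ∀ N : ℕ, 1 ≤ N →
        |PowerSeries.coeff n (QuarticTensor.rescaledCumulant B N -
            ∑ l ∈ Finset.range (q + 1), QuarticTensor.loopPart B l N)| ≤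
          A * (N : ℝ) ^ (-(((D : ℤ) - 2) * ((q : ℤ) + 1))))) := by
  classical
  refine ⟨fun V E C _ _ _ M hM => ⟨hM.loopNumber_nonneg, hM.numInternalFaces_le hD⟩,
    fun p B => ⟨?_, ?_, ?_, ?_, ?_, ?_⟩⟩
  · rintro n G hG rfl N hN
    rw [G.amplitude_div hN]
    exact zpow_le_zpow_right₀ (by exact_mod_cast hN) (neg_le_neg (hG.le_decay hD))
  · intro n
    refine ⟨((n.factorial : ℝ) * 2 ^ n)⁻¹ * Finset.card
      {G : QuarticTensor.FeynmanGraph D n p | G.Connected ∧ G.boundary = B}, fun N hN => ?_⟩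
    rw [QuarticTensor.coeff_rescaledCumulant B hN]
    refine (QuarticTensor.FeynmanGraph.abs_sum_decay_le (m := 0)
      (fun G hG => (Finset.mem_filter.mp hG).2.1.decay_nonneg hD) (by positivity) hN).trans ?_
    rw [neg_zero, zpow_zero, mul_one]
  · have hpoly : ∀ n, ∃ P : Polynomial ℝ, ∀ N : ℕ, 1 ≤ N →
        PowerSeries.coeff n (QuarticTensor.rescaledCumulant B N) = P.eval (N : ℝ)⁻¹ := by
      intro n
      obtain ⟨P, hP⟩ := QuarticTensor.FeynmanGraph.exists_polynomial_sum_decay (m := 0)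
        (s := {G : QuarticTensor.FeynmanGraph D n p | G.Connected ∧ G.boundary = B})
        (fun G hG => (Finset.mem_filter.mp hG).2.1.decay_nonneg hD)
        ((n.factorial : ℝ) * 2 ^ n)⁻¹
      refine ⟨P, fun N hN => ?_⟩
      rw [QuarticTensor.coeff_rescaledCumulant B hN, hP N hN, neg_zero, zpow_zero, one_mul]
    choose P hP using hpoly
    refine ⟨PowerSeries.mk fun n => (P n).eval 0, fun n => ?_⟩
    rw [PowerSeries.coeff_mk]
    refine (((P n).continuous.tendsto 0).comp (tendsto_inv_atTop_nhds_zero_nat (𝕜 := ℝ))).congr' ?_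
    filter_upwards [Filter.eventually_ge_atTop 1] with N hN
    exact (hP n N hN).symm
  · exact fun N hN n => QuarticTensor.coeff_rescaledCumulant_eq_sum B hN n
  · intro l n
    obtain ⟨P, hP⟩ := QuarticTensor.FeynmanGraph.exists_polynomial_sum_decay
      (m := ((D : ℤ) - 2) * (l : ℤ))
      (s := {G : QuarticTensor.FeynmanGraph D n p |
        (G.Connected ∧ G.boundary = B) ∧ G.toMap.loopNumber = (l : ℤ)})
      (fun G hG => by
        have h := (Finset.mem_filter.mp hG).2
        exact h.2 ▸ h.1.1.le_decay hD)
      ((n.factorial : ℝ) * 2 ^ n)⁻¹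
    exact ⟨P, fun N hN => (QuarticTensor.coeff_loopPart B l hN n).trans (hP N hN)⟩
  · intro q n
    refine ⟨((n.factorial : ℝ) * 2 ^ n)⁻¹ * Finset.card
      {G : QuarticTensor.FeynmanGraph D n p | (G.Connected ∧ G.boundary = B) ∧
        ¬ G.toMap.loopNumber < ((q + 1 : ℕ) : ℤ)}, fun N hN => ?_⟩
    rw [QuarticTensor.coeff_remainder B hN]
    refine QuarticTensor.FeynmanGraph.abs_sum_decay_le (fun G hG => ?_) (by positivity) hN
    have h := (Finset.mem_filter.mp hG).2
    refine le_trans (mul_le_mul_of_nonneg_left ?_ (by omega)) (h.1.1.le_decay hD)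
    exact_mod_cast not_lt.mp h.2
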